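/- **Theorem (High-probability bound for the reuse error).** Consider a Markov decision process with measurable state space $\mathcal S$ and action space $\mathcal A$, initial state distribution $\mu$, transition kernel $\mathcal P(\cdot\mid s,a)$, measurable reward function $r:\mathcal S\times\mathcal A\to\mathbb R$ and discount factor $\gamma\in(0,1)$. For a policy $\pi$ (a Markov kernel from $\mathcal S$ to $\mathcal A$) let $p^{\pi}$ be the law of the infinite trajectory $\tau=(s_t,a_t)_{t\ge 0}$ with $s_0\sim\mu$, $a_t\sim\pi(\cdot\mid s_t)$, $s_{t+1}\sim\mathcal P(\cdot\mid s_t,a_t)$. Put $R(\tau)=\sum_{t\ge 0}\gamma^t r(s_t,a_t)$ and $J(\pi)=\mathbb E_{\tau\sim p^\pi}[R(\tau)]$. For policies $\pi,\hat\pi$ write $p^\pi(\tau)/p^{\hat\pi}(\tau)$ for any version of the likelihood ratio, i.e. any real function of $\tau$ that agrees $p^{\hat\pi}$-almost everywhere with the Radon–Nikodym derivative of (the absolutely continuous part of) $p^\pi$ with respect to $p^{\hat\pi}$. Let $\mathcal H$ be an arbitrary set of policies, $\hat\pi$ a policy, $m\ge 2$ an integer and $\delta\in(0,1)$. Assume that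 the returns lie in $[0,1]$: for every $\pi\in\mathcal H\cup\{\hat\pi\}$ and $p^\pi$-almost every $\tau$, the series $R(\tau)$ converges and $0\le R(\tau)\le 1$. Fix a version of $p^\pi/p^{\hat\pi}$ for each $\pi\in\mathcal H$. Let $\mathcal O$ be an arbitrary off-policy algorithm, that is, any map taking an initial policy $\pi_0\in\mathcal H$ and a buffer $\mathcal B=(\tau_1,\dots,\tau_m)$ of trajectories to a policy $\mathcal O(\pi_0,\mathcal B)\in\mathcal H$, and let $\pi_0\in\mathcal H$. Define $$\epsilon_{\mathrm{RE}}(\mathcal O,\pi_0,\mathcal B)=\frac1m\sum_{i=1}^m\frac{p^{\mathcal O(\pi_0,\mathcal B)}(\tau_i)}{p^{\hat\pi}(\tau_i)}R(\tau_i)-J(\mathcal O(\pi_0,\mathcal B)),$$ $$\epsilon_1=\mathrm{KL}\left[p^{\mathcal O(\pi_0,\mathcal B)}\,\middle\|\,p^{\hat\pi}\right]\in[0,\infty],\qquad \epsilon_2=\frac1m\sum_{i=1}^m\left|1-\frac{p^{\mathcal O(\pi_0,\mathcal B)}(\tau_i)}{p^{\hat\pi}(\tau_i)}\right|.$$ Then,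 with probability at least $1-\delta$ over a buffer $\mathcal B$ of $m$ i.i.d. trajectories drawn from $p^{\hat\pi}$, $$|\epsilon_{\mathrm{RE}}(\mathcal O,\pi_0,\mathcal B)|\le\sqrt{\frac{m\,\epsilon_1+\log\left(m^2/\delta\right)}{m-1}}+\epsilon_2 .$$ Here "with probability at least $1-\delta$" means that the inequality holds for all $\mathcal B$ in some measurable set of probability at least $1-\delta$; no measurability of $\mathcal O$ is assumed. -/

import Mathlib

open MeasureTheory ProbabilityTheory InformationTheory
open scoped ENNReal

namespace ReuseBias

/-- A Markov decision process on measurable state and action spaces: transition kernel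
`P(· | s, a)`, reward function `r(s, a)`, initial state distribution `μ₀`, discount factor `γ`. -/
structure MDP (S A : Type*) [MeasurableSpace S] [MeasurableSpace A] where
  /-- initial state distribution -/
  init : Measure S
  init_prob : IsProbabilityMeasure init
  /-- transition dynamic -/
  trans : Kernel (S × A) S
  trans_markov : IsMarkovKernel trans
  /-- reward function -/
  reward : S × A → ℝ
  reward_meas : Measurable reward
  /-- discount factor -/
  γ : ℝ
  γ_mem : γ ∈ Set.Ioo (0 : ℝ) 1

/-- A policy assigns to each state (measurably) a probability distribution over actions. -/
structure Policy (S A : Type*) [MeasurableSpace S] [MeasurableSpace A] where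
  toKernel : Kernel S A
  markov : IsMarkovKernel toKernel

attribute [instance] MDP.init_prob MDP.trans_markov Policy.markov

/-- An infinite trajectory `((s₀, a₀), (s₁, a₁), …)`; the rewards `r_t = r(s_t, a_t)` are
determined by the state-action pairs. -/
abbrev Trajectory (S A : Type*) : Type _ := ℕ → S × A

namespace MDP

variable {S A : Type*} [MeasurableSpace S] [MeasurableSpace A]

/-- One step of the interaction, as a kernel from the history up to time `n` to the next
state-action pair: `s_{n+1} ∼ P(· | s_n, a_n)` and then `a_{n+1} ∼ π(· | s_{n+1})`. -/
noncomputable def step (M : MDP S A) (π : Policy S A) (n : ℕ) :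
    Kernel ((i : Finset.Iic n) → (fun _ : ℕ => S × A) i) (S × A) :=
  (M.trans ⊗ₖ Kernel.prodMkLeft (S × A) π.toKernel).comap
    (fun h => h ⟨n, Finset.mem_Iic.2 le_rfl⟩) (measurable_pi_apply _)

instance (M : MDP S A) (π : Policy S A) (n : ℕ) : IsMarkovKernel (M.step π n) := by
  unfold step; infer_instance

/-- The trajectory distribution `p^π`: the law on infinite trajectories with
`s₀ ∼ μ₀`, `a_t ∼ π(· | s_t)`, `s_{t+1} ∼ P(· | s_t, a_t)` (Ionescu-Tulcea). -/
noncomputable def trajLaw (M : MDP S A) (π : Policy S A) : Measure (Trajectory S A) :=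
  Kernel.trajMeasure (X := fun _ : ℕ => S × A) (M.init ⊗ₘ π.toKernel) (M.step π)

instance (M : MDP S A) (π : Policy S A) : IsProbabilityMeasure (M.trajLaw π) := by
  unfold trajLaw; infer_instance

/-- The law of a replay buffer of `m` i.i.d. trajectories sampled by the policy `π`. -/
noncomputable def bufferLaw (M : MDP S A) (π : Policy S A) (m : ℕ) :
    Measure (Fin m → Trajectory S A) :=
  Measure.pi fun _ => M.trajLaw π

/-- The discounted return `R(τ) = ∑ γ^t r_t` of a trajectory. -/
noncomputable def ret (M : MDP S A) (τ : Trajectory S A) : ℝ :=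
  ∑' t : ℕ, M.γ ^ t * M.reward (τ t)

/-- The return of `τ` is well defined (the series converges) and lies in `[0, 1]`. -/
def ReturnInUnit (M : MDP S A) (τ : Trajectory S A) : Prop :=
  Summable (fun t : ℕ => M.γ ^ t * M.reward (τ t)) ∧ M.ret τ ∈ Set.Icc (0 : ℝ) 1

/-- The performance `J(π) = 𝔼_{τ ∼ π} R(τ)`. -/
noncomputable def J (M : MDP S A) (π : Policy S A) : ℝ :=
  ∫ τ, M.ret τ ∂(M.trajLaw π)

/-- `w` is (a version of) the likelihood ratio `τ ↦ p^π(τ) / p^π'(τ)` of the trajectory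
distributions: it agrees with the Radon-Nikodym derivative for almost every trajectory of `π'`.
A quotient of densities with respect to a common σ-finite reference measure is such a version. -/
def IsLikelihoodRatio (M : MDP S A) (π π' : Policy S A) (w : Trajectory S A → ℝ) : Prop :=
  ∀ᵐ τ ∂(M.trajLaw π'), w τ = ((M.trajLaw π).rnDeriv (M.trajLaw π') τ).toReal

/-- The importance sampling estimate `(1/m) ∑ᵢ w(τᵢ) R(τᵢ)` with likelihood ratio `w`. -/
noncomputable def isEstimate (M : MDP S A) {m : ℕ} (w : Trajectory S A → ℝ)
    (B : Fin m → Trajectory S A) : ℝ :=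
  (1 / (m : ℝ)) * ∑ i, w (B i) * M.ret (B i)

/-- The reuse error of an off-policy algorithm `O` on the initial policy `π₀` and the buffer `B`;
`ratio π` is the likelihood ratio of `π` with respect to the sampling policy. -/
noncomputable def reuseError (M : MDP S A) {m : ℕ} {H : Set (Policy S A)}
    (ratio : H → Trajectory S A → ℝ) (O : H → (Fin m → Trajectory S A) → H) (π₀ : H)
    (B : Fin m → Trajectory S A) : ℝ :=
  M.isEstimate (ratio (O π₀ B)) B - M.J (O π₀ B)

/-- `ε₁`: the Kullback-Leibler divergence of the trajectory distributions. -/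
noncomputable def eps1 (M : MDP S A) (π π' : Policy S A) : ℝ≥0∞ :=
  klDiv (M.trajLaw π) (M.trajLaw π')

end MDP

/-- `ε₂`: the average over the buffer of `|1 - w(τᵢ)|`, for a likelihood ratio `w`. -/
noncomputable def eps2 {S A : Type*} {m : ℕ} (w : Trajectory S A → ℝ)
    (B : Fin m → Trajectory S A) : ℝ :=
  (1 / (m : ℝ)) * ∑ i, |1 - w (B i)|

end ReuseBias

namespace ReuseBias

/-! The output policy π depends on the buffer, yet no union bound over policies is needed. Split the
reuse error into (estimate − mean return) + (mean return − J(π̂)) + (J(π̂) − J(π)). The first term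
is at most ε₂ buffer by buffer, since returns lie in [0, 1]; the third is controlled by ε₁ through
Pinsker. Only the middle term is random, and it does not involve π, so one Hoeffding event serves
every π at once. -/

/-- Young's inequality for the pair of conjugate functions `klFun` and `y ↦ exp y - 1`. -/
lemma mul_le_klFun_add_exp {x : ℝ} (hx : 0 ≤ x) (y : ℝ) :
    x * y ≤ klFun x + (Real.exp y - 1) := by
  rcases hx.eq_or_lt with rfl | hx
  · simpa [klFun_zero] using (Real.exp_pos y).le
  · have h := Real.add_one_le_exp (y - Real.log x)
    rw [Real.exp_sub, Real.exp_log hx, le_div_iff₀ hx] at h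
    rw [klFun_apply]
    linarith

/-- A variational inequality for the Kullback-Leibler divergence, in the spirit of
Donsker and Varadhan. -/
lemma integral_le_toReal_klDiv_add {Ω : Type*} [MeasurableSpace Ω] {P Q : Measure Ω}
    [IsProbabilityMeasure P] [IsProbabilityMeasure Q] (hKL : klDiv P Q ≠ ∞) {g : Ω → ℝ}
    (hg : Integrable g P) (hexp : Integrable (fun ω => Real.exp (g ω)) Q) :
    ∫ ω, g ω ∂P ≤ (klDiv P Q).toReal + (∫ ω, Real.exp (g ω) ∂Q - 1) := by
  obtain ⟨hPQ, hllr⟩ := klDiv_ne_top_iff.1 hKL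
  have hkl := (integrable_klFun_rnDeriv_iff hPQ).2 hllr
  have hexp' : Integrable (fun ω => Real.exp (g ω) - 1) Q := hexp.sub (integrable_const 1)
  rw [toReal_klDiv_eq_integral_klFun hPQ, ← integral_rnDeriv_smul hPQ]
  have h1 : ∫ ω, Real.exp (g ω) ∂Q - 1 = ∫ ω, (Real.exp (g ω) - 1) ∂Q := by
    rw [integral_sub hexp (integrable_const 1)]; simp
  rw [h1, ← integral_add hkl hexp']
  refine integral_mono ((integrable_rnDeriv_smul_iff hPQ).2 hg) (hkl.add hexp') fun ω => ?_
  exact mul_le_klFun_add_exp ENNReal.toReal_nonneg _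

/-- Pinsker's inequality, for the expectations of a function with values in `[0, 1]`. -/
lemma sq_integral_sub_integral_le {Ω : Type*} [MeasurableSpace Ω] {P Q : Measure Ω}
    [IsProbabilityMeasure P] [IsProbabilityMeasure Q] (hKL : klDiv P Q ≠ ∞) {f : Ω → ℝ}
    (hf : AEMeasurable f Q) (hf01 : ∀ᵐ ω ∂Q, f ω ∈ Set.Icc (0 : ℝ) 1) :
    2 * (∫ ω, f ω ∂P - ∫ ω, f ω ∂Q) ^ 2 ≤ (klDiv P Q).toReal := by
  have hPQ := (klDiv_ne_top_iff.1 hKL).1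
  have hfP : Integrable f P := Integrable.of_mem_Icc 0 1 (hf.mono_ac hPQ) (hPQ.ae_le hf01)
  set d := ∫ ω, f ω ∂P - ∫ ω, f ω ∂Q with hd
  set c := ∫ ω, f ω ∂Q with hc
  have hsub := hasSubgaussianMGF_of_mem_Icc hf hf01
  -- Hoeffding's lemma bounds the log-MGF at `t` by `t ^ 2 / 8`; `t = 4 * d` maximises `t * d - t ^
  -- 2 / 8`, with value `2 * d ^ 2`. Subtracting this value below brings the exponential moment
  -- under 1, so the `exp` term of the variational bound drops out.
  have hint := hsub.integrable_exp_mul (4 * d)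
  have hmgf := hsub.mgf_le (4 * d)
  simp only [mgf] at hmgf
  have hlin : Integrable (fun ω => 4 * d * (f ω - c)) P :=
    (hfP.sub (integrable_const c)).const_mul _
  have hg : Integrable (fun ω => 4 * d * (f ω - c) - 2 * d ^ 2) P :=
    hlin.sub (integrable_const _)
  have hexp_eq : ∀ ω, Real.exp (4 * d * (f ω - c) - 2 * d ^ 2)
      = Real.exp (4 * d * (f ω - c)) * Real.exp (-(2 * d ^ 2)) := fun ω => by
    rw [← Real.exp_add, sub_eq_add_neg]
  have hexp : Integrable (fun ω => Real.exp (4 * d * (f ω - c) - 2 * d ^ 2)) Q := by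
    simp_rw [hexp_eq]
    exact hint.mul_const _
  have hexp_le : ∫ ω, Real.exp (4 * d * (f ω - c) - 2 * d ^ 2) ∂Q ≤ 1 := by
    simp_rw [hexp_eq]
    rw [integral_mul_const]
    calc _ ≤ Real.exp (2 * d ^ 2) * Real.exp (-(2 * d ^ 2)) := by
          gcongr
          refine hmgf.trans (Real.exp_le_exp.2 (le_of_eq ?_))
          simp
          ring
      _ = 1 := by rw [← Real.exp_add]; simp
  have hgP : ∫ ω, (4 * d * (f ω - c) - 2 * d ^ 2) ∂P = 2 * d ^ 2 := by
    rw [integral_sub hlin (integrable_const _),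
      integral_const_mul, integral_sub hfP (integrable_const c)]
    simp only [integral_const, probReal_univ, one_smul]
    rw [← hd]
    ring
  have := integral_le_toReal_klDiv_add hKL hg hexp
  linarith

/-- Hoeffding's inequality, one-sided, for the centred sum of `m` i.i.d. copies of a
sub-Gaussian random variable with variance proxy `1 / 4`. -/
lemma measureReal_pi_sum_ge_le {Ω : Type*} [MeasurableSpace Ω] {Q : Measure Ω}
    [IsProbabilityMeasure Q] {g : Ω → ℝ} (hg : HasSubgaussianMGF g (1 / 4) Q)
    {m : ℕ} (hm : 0 < m) {ε : ℝ} (hε : 0 ≤ ε) :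
    (Measure.pi fun _ : Fin m => Q).real {B | m * ε ≤ ∑ i, g (B i)}
      ≤ Real.exp (-(2 * m * ε ^ 2)) := by
  have hsub : ∀ i ∈ (Finset.univ : Finset (Fin m)),
      HasSubgaussianMGF (fun B : Fin m → Ω => g (B i)) (1 / 4) (Measure.pi fun _ => Q) := by
    intro i _
    refine HasSubgaussianMGF.of_map (Y := fun B : Fin m → Ω => B i) (X := g)
      (measurable_pi_apply i).aemeasurable ?_
    rwa [(measurePreserving_eval (fun _ : Fin m => Q) i).map_eq]
  have hm' : (0 : ℝ) < m := by exact_mod_cast hm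
  refine (HasSubgaussianMGF.measure_sum_ge_le_of_iIndepFun
    (iIndepFun_pi fun _ => hg.aemeasurable) hsub (by positivity)).trans
    (Real.exp_le_exp.2 (le_of_eq ?_))
  simp
  field_simp
  ring

/-- Hoeffding's inequality for the empirical mean of a function with values in `[0, 1]`. -/
lemma measureReal_pi_abs_mean_sub_ge_le {Ω : Type*} [MeasurableSpace Ω] {Q : Measure Ω}
    [IsProbabilityMeasure Q] {f : Ω → ℝ} (hf : AEMeasurable f Q)
    (hf01 : ∀ᵐ ω ∂Q, f ω ∈ Set.Icc (0 : ℝ) 1) {m : ℕ} (hm : 0 < m) {ε : ℝ} (hε : 0 ≤ ε) :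
    (Measure.pi fun _ : Fin m => Q).real
        {B | ε ≤ |1 / (m : ℝ) * ∑ i, f (B i) - ∫ ω, f ω ∂Q|}
      ≤ 2 * Real.exp (-(2 * m * ε ^ 2)) := by
  have hm' : (0 : ℝ) < m := by exact_mod_cast hm
  have hsub : HasSubgaussianMGF (fun ω => f ω - ∫ ω, f ω ∂Q) (1 / 4) Q := by
    convert hasSubgaussianMGF_of_mem_Icc hf hf01 using 1
    ext
    norm_num
  have h1 := measureReal_pi_sum_ge_le hsub hm hε
  have h2 := measureReal_pi_sum_ge_le hsub.neg hm hε
  refine (measureReal_mono ?_).trans ((measureReal_union_le _ _).trans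
    ((add_le_add h1 h2).trans_eq (two_mul _).symm))
  intro B hB
  have hmean : 1 / (m : ℝ) * ∑ i, f (B i) - ∫ ω, f ω ∂Q
      = (∑ i, (f (B i) - ∫ ω, f ω ∂Q)) / m := by
    rw [Finset.sum_sub_distrib]
    simp
    field_simp
  rw [Set.mem_ofPred_eq, hmean, le_abs, ← neg_div, le_div_iff₀ hm', le_div_iff₀ hm',
    mul_comm ε] at hB
  simpa [Set.mem_union] using hB

/-- Almost everywhere the return is the limit of its measurable partial sums. -/
lemma MDP.aemeasurable_ret {S A : Type*} [MeasurableSpace S] [MeasurableSpace A] (M : MDP S A)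
    {Q : Measure (Trajectory S A)} (hQ : ∀ᵐ τ ∂Q, M.ReturnInUnit τ) : AEMeasurable M.ret Q := by
  refine aemeasurable_of_tendsto_metrizable_ae Filter.atTop
    (f := fun n τ => ∑ t ∈ Finset.range n, M.γ ^ t * M.reward (τ t)) (fun n => ?_) ?_
  · have := M.reward_meas
    exact (Finset.measurable_fun_sum _ fun t _ =>
      (this.comp (measurable_pi_apply t)).const_mul _).aemeasurable
  · filter_upwards [hQ] with τ hτ using hτ.1.hasSum.tendsto_sum_nat

/-- Replacing the likelihood ratio by `1` changes the importance sampling estimate by at most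
`eps2` when the returns lie in `[0, 1]`. -/
lemma MDP.abs_isEstimate_sub_mean_le {S A : Type*} [MeasurableSpace S] [MeasurableSpace A]
    (M : MDP S A) {m : ℕ} (w : Trajectory S A → ℝ) {B : Fin m → Trajectory S A}
    (hB : ∀ i, M.ret (B i) ∈ Set.Icc (0 : ℝ) 1) :
    |M.isEstimate w B - 1 / (m : ℝ) * ∑ i, M.ret (B i)| ≤ eps2 w B := by
  rw [isEstimate, eps2, ← mul_sub, ← Finset.sum_sub_distrib, abs_mul,
    abs_of_nonneg (by positivity : (0 : ℝ) ≤ 1 / m)]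
  gcongr
  refine (Finset.abs_sum_le_sum_abs _ _).trans (Finset.sum_le_sum fun i _ => ?_)
  rw [← sub_one_mul, abs_mul, abs_sub_comm, abs_of_nonneg (hB i).1]
  exact mul_le_of_le_one_right (abs_nonneg _) (hB i).2

/-- If the empirical mean of the returns is accurate, the reuse error obeys the claimed bound. -/
lemma MDP.ofReal_abs_isEstimate_sub_J_le {S A : Type*} [MeasurableSpace S] [MeasurableSpace A]
    (M : MDP S A) (π π' : Policy S A) (hR : ∀ᵐ τ ∂(M.trajLaw π'), M.ReturnInUnit τ)
    {m : ℕ} (hm : 2 ≤ m) {L : ℝ} (hL : 0 ≤ L) (w : Trajectory S A → ℝ)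
    {B : Fin m → Trajectory S A} (hB : ∀ i, M.ret (B i) ∈ Set.Icc (0 : ℝ) 1)
    (hmean : |1 / (m : ℝ) * ∑ i, M.ret (B i) - M.J π'| ≤ √(L / (2 * m))) :
    ENNReal.ofReal |M.isEstimate w B - M.J π| ≤
      (((m : ℝ≥0∞) * M.eps1 π π' + ENNReal.ofReal L) / ((m : ℝ≥0∞) - 1)) ^ (1 / 2 : ℝ)
        + ENNReal.ofReal (eps2 w B) := by
  have hm2 : (2 : ℝ) ≤ m := by exact_mod_cast hm
  have hm1 : (m : ℝ≥0∞) - 1 = ENNReal.ofReal ((m : ℝ) - 1) := by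
    rw [ENNReal.ofReal_sub _ zero_le_one]; simp
  rw [hm1]
  -- Infinite divergence, which includes failure of absolute continuity, makes the right side
  -- infinite.
  by_cases hK : M.eps1 π π' = ∞
  · have hm0 : (m : ℝ≥0∞) ≠ 0 := by exact_mod_cast (by lia : m ≠ 0)
    rw [hK, ENNReal.mul_top hm0, top_add, ENNReal.top_div_of_ne_top ENNReal.ofReal_ne_top,
      ENNReal.top_rpow_of_pos (by norm_num), top_add]
    exact le_top
  set K := (M.eps1 π π').toReal with hKdef
  have hK0 : 0 ≤ K := ENNReal.toReal_nonneg
  have hrhs : (((m : ℝ≥0∞) * M.eps1 π π' + ENNReal.ofReal L) / ENNReal.ofReal ((m : ℝ) - 1))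
        ^ (1 / 2 : ℝ) = ENNReal.ofReal √((m * K + L) / (m - 1)) := by
    rw [← ENNReal.ofReal_toReal hK, ← hKdef, ← ENNReal.ofReal_natCast,
      ← ENNReal.ofReal_mul (by positivity), ← ENNReal.ofReal_add (by positivity) hL,
      ← ENNReal.ofReal_div_of_pos (by linarith), Real.sqrt_eq_rpow,
      ENNReal.ofReal_rpow_of_nonneg (div_nonneg (by positivity) (by linarith)) (by norm_num)]
  have heps2 : 0 ≤ eps2 w B := (abs_nonneg _).trans (M.abs_isEstimate_sub_mean_le w hB)
  rw [hrhs, ← ENNReal.ofReal_add (Real.sqrt_nonneg _) heps2]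
  refine ENNReal.ofReal_le_ofReal ?_
  have hpinsker : 2 * (M.J π - M.J π') ^ 2 ≤ K :=
    sq_integral_sub_integral_le hK (M.aemeasurable_ret hR) (hR.mono fun _ h => h.2)
  have hmean_sq : (1 / (m : ℝ) * ∑ i, M.ret (B i) - M.J π') ^ 2 ≤ L / (2 * m) := by
    rw [← sq_abs, ← Real.sq_sqrt (by positivity : 0 ≤ L / (2 * m))]
    gcongr
  have hmean_le : |1 / (m : ℝ) * ∑ i, M.ret (B i) - M.J π| ≤ √((m * K + L) / (m - 1)) := by
    refine Real.abs_le_sqrt ?_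
    -- The factor 2 in `(a + b) ^ 2 ≤ 2 * a ^ 2 + 2 * b ^ 2` is absorbed exactly by the Hoeffding
    -- radius and by Pinsker. This already gives denominator `m`; `m - 1` is slack.
    calc (1 / (m : ℝ) * ∑ i, M.ret (B i) - M.J π) ^ 2
        ≤ 2 * (1 / (m : ℝ) * ∑ i, M.ret (B i) - M.J π') ^ 2 + 2 * (M.J π - M.J π') ^ 2 := by
          linarith [sq_nonneg ((1 / (m : ℝ) * ∑ i, M.ret (B i) - M.J π')
            + (M.J π - M.J π'))]
      _ ≤ 2 * (L / (2 * m)) + K := by gcongr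
      _ = (m * K + L) / m := by field_simp; ring
      _ ≤ (m * K + L) / (m - 1) := by
          gcongr
          · linarith
          · linarith
  calc |M.isEstimate w B - M.J π|
      ≤ |M.isEstimate w B - 1 / (m : ℝ) * ∑ i, M.ret (B i)|
        + |1 / (m : ℝ) * ∑ i, M.ret (B i) - M.J π| := abs_sub_le _ _ _
    _ ≤ √((m * K + L) / (m - 1)) + eps2 w B := by
        linarith [M.abs_isEstimate_sub_mean_le w hB]

end ReuseBias

theorem mainTheorem4 {S A : Type*} [MeasurableSpace S] [MeasurableSpace A]
    (M : ReuseBias.MDP S A)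
    -- the hypothesis set of policies and the policy that generates the buffer
    (H : Set (ReuseBias.Policy S A)) (πhat : ReuseBias.Policy S A)
    -- returns lie in `[0, 1]` for the trajectories that the policies can generate
    (hR : ∀ π ∈ insert πhat H, ∀ᵐ τ ∂(M.trajLaw π), M.ReturnInUnit τ)
    -- the likelihood ratios `p^π / p^πhat`, in any version
    (ratio : H → ReuseBias.Trajectory S A → ℝ)
    (hratio : ∀ π : H, M.IsLikelihoodRatio π πhat (ratio π))
    (m : ℕ) (hm : 2 ≤ m) (δ : ℝ) (hδ : δ ∈ Set.Ioo (0 : ℝ) 1)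
    -- any off-policy algorithm and any initialized policy
    (O : H → (Fin m → ReuseBias.Trajectory S A) → H) (π₀ : H) :
    -- with probability at least `1 - δ` over the buffer
    ∃ G : Set (Fin m → ReuseBias.Trajectory S A), MeasurableSet G ∧
      ENNReal.ofReal (1 - δ) ≤ M.bufferLaw πhat m G ∧
      ∀ B ∈ G,
        ENNReal.ofReal |M.reuseError ratio O π₀ B| ≤
          (((m : ℝ≥0∞) * M.eps1 (O π₀ B) πhat + ENNReal.ofReal (Real.log ((m : ℝ) ^ 2 / δ)))
              / ((m : ℝ≥0∞) - 1)) ^ (1 / 2 : ℝ)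
            + ENNReal.ofReal (ReuseBias.eps2 (ratio (O π₀ B)) B) := by

  have hRhat : ∀ᵐ τ ∂(M.trajLaw πhat), M.ReturnInUnit τ := hR πhat (Set.mem_insert _ _)
  have hm2 : (2 : ℝ) ≤ m := by exact_mod_cast hm
  obtain ⟨hδ0, hδ1⟩ := hδ
  set L := Real.log ((m : ℝ) ^ 2 / δ) with hLdef
  have hL : 0 ≤ L := Real.log_nonneg ((one_le_div hδ0).2 (by nlinarith))
  set ε := √(L / (2 * m)) with hεdef
  set far : Set (Fin m → ReuseBias.Trajectory S A) :=
    {B | ε ≤ |1 / (m : ℝ) * ∑ i, M.ret (B i) - M.J πhat|} with hfar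
  set off : Set (Fin m → ReuseBias.Trajectory S A) :=
    {B | ¬ ∀ i, M.ReturnInUnit (B i)} with hoff
  have hfar_le : (M.bufferLaw πhat m).real far ≤ δ := by
    refine (ReuseBias.measureReal_pi_abs_mean_sub_ge_le (M.aemeasurable_ret hRhat)
      (hRhat.mono fun _ h => h.2) (by lia) (Real.sqrt_nonneg _)).trans ?_
    have hexp : -(2 * m * √(L / (2 * m)) ^ 2) = -L := by
      rw [Real.sq_sqrt (by positivity)]
      field_simp
    rw [hexp, Real.exp_neg, hLdef, Real.exp_log (by positivity), inv_div, ← mul_div_assoc,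
      div_le_iff₀ (by positivity), mul_comm]
    -- The failure probability is at most `2 * δ / m ^ 2`, and `2 ≤ m ^ 2`.
    exact mul_le_mul_of_nonneg_left (by nlinarith) hδ0.le
  have hoff_zero : M.bufferLaw πhat m off = 0 := by
    refine ae_iff.1 (ae_all_iff.2 fun i => ?_)
    exact (measurePreserving_eval (fun _ : Fin m => M.trajLaw πhat) i).quasiMeasurePreserving.ae
      hRhat
  have : IsProbabilityMeasure (M.bufferLaw πhat m) := by
    unfold ReuseBias.MDP.bufferLaw; infer_instance
  -- The bad set is defined without `O`, so `O` need not be measurable; the measurable hull makes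
  -- the good set measurable at no cost in probability.
  refine ⟨(toMeasurable (M.bufferLaw πhat m) (far ∪ off))ᶜ,
    (measurableSet_toMeasurable _ _).compl, ?_, fun B hB => ?_⟩
  · rw [prob_compl_eq_one_sub (measurableSet_toMeasurable _ _), measure_toMeasurable,
      ENNReal.ofReal_sub _ hδ0.le, ENNReal.ofReal_one]
    refine tsub_le_tsub_left ((measure_union_le _ _).trans ?_) _
    rw [hoff_zero, add_zero, ← ofReal_measureReal]
    exact ENNReal.ofReal_le_ofReal hfar_le
  · have hB' : B ∉ far ∪ off := fun h => hB (subset_toMeasurable _ _ h)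
    simp only [hfar, hoff, Set.mem_union, Set.mem_ofPred_eq, not_or, not_not, not_le] at hB'
    exact M.ofReal_abs_isEstimate_sub_J_le (O π₀ B) πhat hRhat hm hL (ratio (O π₀ B))
      (fun i => (hB'.2 i).2) hB'.1.le
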